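/- Consider a stochastic bandit with $M\ge 2$ categories of $K\ge 1$ arms each, arm $k$ of category $m$ having mean $\mu_k^m$. At each step $t=1,2,\dots$ the agent chooses an arm $(C_t,A_t)$ from the information available before step $t$ (the past arms and rewards, and possibly extra randomness) and receives $X_t=\mu_{A_t}^{C_t}+\eta_t$, where, conditionally on that information and on $(C_t,A_t)$, the noise is $1$-sub-Gaussian: $\mathbb E[e^{\lambda\eta_t}\mid\cdot\,]\le e^{\lambda^2/2}$ for all $\lambda\in\mathbb R$. Label arms so that $\mu_1^m\ge\dots\ge\mu_K^m$ for each $m$, and suppose that category $1$ strongly dominates every other category: $\mu_k^1\ge\mu_l^m$ for all $m\ge2$ and all $k,l$ (the labelling and the dominating category are unknown to the agent). Put $\Delta_{m,k}=\mu_1^1-\mu_k^m$, $\Delta_{\sharp,K}=\min_{2\le m\le M}\Delta_{m,K}$ and $R_T=\sum_{t=1}^T(\mu_1^1-\mu_{A_t}^{C_t})$. For $\delta\in(0,1)$ let $N_k^m(t)$ and $\widehat\mu_k^m(t)$ be the number of pulls and the empirical mean of arm $(m,k)$ over the steps before $t$, and $$C_m^+(t,\delta)=\max_{k}\Big(\widehat\mu_k^m(t)-\sqrt{\tfrac{2\log(1/\delta)}{N_k^m(t)}}\Big),\qquad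 C_m^-(t,\delta)=\min_{k}\Big(\widehat\mu_k^m(t)+\sqrt{\tfrac{2\log(1/\delta)}{N_k^m(t)}}\Big).$$ The algorithm MinMaxUCB$(\delta)$ first pulls each arm once, and then iterates the following. At the start $t$ of an iteration it rejects, for good, every category $m$ such that $C_n^+(t,\delta)>C_m^-(t,\delta)$ for some category $n\ne m$; the categories not rejected so far are called active. If at least two categories are active, it pulls each arm of the active categories once; if exactly one category $m$ is active, it makes one pull of an arm of $m$ that maximizes $\widehat\mu_k^{m}(t)+\sqrt{2\log(1/\delta)/N_k^{m}(t)}$ over $k$; if none is active, it pulls all arms once. (Ties and the order of the pulls inside an iteration are arbitrary.) Then, for every horizon $T\ge 0$, with probability at least $1-2\delta MKT$, $$R_T\le 8\sum_{k=2}^K\max\Big\{\frac1{\Delta_{1,k}},\frac{4\Delta_{1,k}}{\Delta_{\sharp,K}^2}\Big\}\log\frac1\delta+\sum_{m=1}^M\sum_{k=1}^K\Delta_{m,k}+\sum_{m=2}^M\frac{32\log\frac1\delta}{\Delta_{m,K}^2}\Big(\sum_{k=1}^K\Delta_{m,k}\Big),$$ where, if some gaps vanish, a quotient with denominator $0$ is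 read as $0$. -/

import Mathlib

open MeasureTheory ProbabilityTheory

noncomputable section

namespace CategorizedBandit

variable {M K : ℕ}

/-! ### Empirical quantities

Arms are pairs `(m, k)`: arm `k` of category `m`.  Time is counted from `0`: `a s` is the arm pulled
at step `s`, `x s` the reward it returns, and the data available "at time `t`" are the
steps `s < t`. -/

/-- Number of pulls of the arm `j` during the steps `s < t`. -/
def pulls (a : ℕ → Fin M × Fin K) (t : ℕ) (j : Fin M × Fin K) : ℕ :=
  ((Finset.range t).filter fun s => a s = j).card

/-- Empirical mean of the arm `j` over the steps `s < t`. -/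
def empMean (a : ℕ → Fin M × Fin K) (x : ℕ → ℝ) (t : ℕ) (j : Fin M × Fin K) : ℝ :=
  (∑ s ∈ (Finset.range t).filter fun s => a s = j, x s) / (pulls a t j : ℝ)

/-- Confidence width `√(2 log(1/δ) / N)` of the arm `j` at time `t`. -/
def width (δ : ℝ) (a : ℕ → Fin M × Fin K) (t : ℕ) (j : Fin M × Fin K) : ℝ :=
  Real.sqrt (2 * Real.log (1 / δ) / (pulls a t j : ℝ))

/-- `C⁺_m(t, δ)`: the best lower confidence bound inside the category `m`. -/
def bestLower (δ : ℝ) (a : ℕ → Fin M × Fin K) (x : ℕ → ℝ) (t : ℕ) (m : Fin M) : ℝ :=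
  ⨆ k : Fin K, (empMean a x t (m, k) - width δ a t (m, k))

/-- `C⁻_m(t, δ)`: the worst upper confidence bound inside the category `m`. -/
def worstUpper (δ : ℝ) (a : ℕ → Fin M × Fin K) (x : ℕ → ℝ) (t : ℕ) (m : Fin M) : ℝ :=
  ⨅ k : Fin K, (empMean a x t (m, k) + width δ a t (m, k))

/-- The category `m` passes the test at time `t`: its worst upper confidence bound is not below the
best lower confidence bound of another category. -/
def PassesTest (δ : ℝ) (a : ℕ → Fin M × Fin K) (x : ℕ → ℝ) (t : ℕ) (m : Fin M) : Prop :=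
  ∀ n : Fin M, n ≠ m → bestLower δ a x t n ≤ worstUpper δ a x t m

open Classical in
/-- The active categories at the `i`-th iteration of the main loop, where the `j`-th iteration
starts at time `τ j`: those which have not been rejected by any test made so far, the test at
time `τ i` included. -/
def activeSet (δ : ℝ) (a : ℕ → Fin M × Fin K) (x : ℕ → ℝ) (τ : ℕ → ℕ) (i : ℕ) : Finset (Fin M) :=
  Finset.univ.filter fun m => ∀ j ≤ i, PassesTest δ a x (τ j) m

/-- During the steps `s, s + 1, …, s' - 1` every arm of `B` is pulled exactly once, in any order,
and no other arm is pulled. -/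
def PullsEachOnce (a : ℕ → Fin M × Fin K) (s s' : ℕ) (B : Finset (Fin M × Fin K)) : Prop :=
  s' = s + B.card ∧ (Finset.Ico s s').image a = B

/-- The sequence of arms `a` with rewards `x` is a run of `MinMaxUCB(δ)`.  First each arm is pulled
once.  Then, at each iteration (the `i`-th one starts at time `τ i`), the active set is updated;
* if no category is active, all arms are pulled once;
* if exactly one category is active, one pull is made inside it, of an arm that maximizes the upper
  confidence bound (ties broken in any way);
* if at least two categories are active, all the arms of the active categories are pulled once. -/
def IsMinMaxUCBRun (δ : ℝ) (a : ℕ → Fin M × Fin K) (x : ℕ → ℝ) : Prop :=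
  ∃ τ : ℕ → ℕ,
    PullsEachOnce a 0 (τ 0) Finset.univ ∧
    ∀ i : ℕ,
      ((activeSet δ a x τ i).card = 0 → PullsEachOnce a (τ i) (τ (i + 1)) Finset.univ) ∧
      ((activeSet δ a x τ i).card = 1 →
        τ (i + 1) = τ i + 1 ∧ (a (τ i)).1 ∈ activeSet δ a x τ i ∧
        ∀ k : Fin K,
          empMean a x (τ i) ((a (τ i)).1, k) + width δ a (τ i) ((a (τ i)).1, k)
            ≤ empMean a x (τ i) (a (τ i)) + width δ a (τ i) (a (τ i))) ∧
      (1 < (activeSet δ a x τ i).card →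
        PullsEachOnce a (τ i) (τ (i + 1)) (activeSet δ a x τ i ×ˢ Finset.univ))

/-! ### The stochastic model -/

/-- Interaction of an agent with the bandit whose arm `(m, k)` has mean `μ m k`.  `ℱ t` is the
information available just before the reward of step `t` is revealed; it contains the past, the
arm `a t` chosen at step `t`, and possibly extra randomness.  Given `ℱ t`, the noise
`X t - μ (a t)` is `1`-sub-Gaussian (and so centered). -/
structure IsBanditInteraction {Ω : Type*} {mΩ : MeasurableSpace Ω} (P : Measure Ω)
    (ℱ : Filtration ℕ mΩ) (μ : Fin M → Fin K → ℝ)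
    (a : ℕ → Ω → Fin M × Fin K) (X : ℕ → Ω → ℝ) : Prop where
  measurable_arm : ∀ t, Measurable[ℱ t] (a t)
  measurable_reward : ∀ t, Measurable[ℱ (t + 1)] (X t)
  integrable_exp : ∀ t, ∀ l : ℝ,
    Integrable (fun ω => Real.exp (l * (X t ω - μ (a t ω).1 (a t ω).2))) P
  condExp_exp_le : ∀ t, ∀ l : ℝ,
    P[fun ω => Real.exp (l * (X t ω - μ (a t ω).1 (a t ω).2)) | ℱ t]
      ≤ᵐ[P] fun _ => Real.exp (l ^ 2 / 2)

/-- Strong dominance between categories with mean vectors `u` and `v`: the worst arm of the first is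
at least as good as the best arm of the second. -/
def StronglyDominates (u v : Fin K → ℝ) : Prop :=
  ∀ k l : Fin K, v l ≤ u k

/-! ### Gaps and regret

The first category and its first arm have index `0`. -/

/-- The gap `Δ_{m,k} = μ_1^1 - μ_k^m`. -/
def gap [NeZero M] [NeZero K] (μ : Fin M → Fin K → ℝ) (m : Fin M) (k : Fin K) : ℝ :=
  μ 0 0 - μ m k

/-- The gap `Δ_{m,K}` of the last arm of the category `m`. -/
def lastGap [NeZero M] [NeZero K] (μ : Fin M → Fin K → ℝ) (m : Fin M) : ℝ :=
  gap μ m ⟨K - 1, Nat.sub_lt (NeZero.pos K) Nat.one_pos⟩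

/-- `Δ_{♯,K}`, the minimum of `Δ_{m,K}` over the categories `m` other than the first one. -/
def sharpGap [NeZero M] [NeZero K] (μ : Fin M → Fin K → ℝ) : ℝ :=
  ⨅ m : {m : Fin M // m ≠ 0}, lastGap μ m.1

/-- The regret `R_T` of the sequence of arms `a` after `T` steps. -/
def regret [NeZero M] [NeZero K] (μ : Fin M → Fin K → ℝ) (a : ℕ → Fin M × Fin K) (T : ℕ) : ℝ :=
  ∑ t ∈ Finset.range T, (μ 0 0 - μ (a t).1 (a t).2)

end CategorizedBandit

end

/-! The proof separates one probabilistic estimate from a pathwise count. For an arm and a number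
`n`, the noise of its first `n` pulls, with the weight `l = ±√(2 log(1/δ)/n)`, gives an exponential
supermartingale of mean at most one. By Markov's inequality each tail costs `δ`. Two signs, `M * K`
arms and `T` possible counts give the failure probability `2 * δ * M * K * T`
(`measureReal_not_confidenceHolds_le`). If all confidence intervals hold, strong dominance keeps
category `0` active. A category `m ≠ 0` that survives after `n` rounds has `lastGap μ m` at most
four common widths, so `n ≤ 32 log(1/δ) / lastGap μ m ^ 2` (`iteration_le`). Once category `0` is
alone, the usual UCB argument allows a pull only if the gap is at most two widths. By `pull_cases`
every pull other than an arm's first is of one of these two kinds; the counts are then weighted by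
the gaps. -/

namespace CategorizedBandit

/-! ### Exponential supermartingales for sub-Gaussian noise -/

section Concentration

variable {Ω : Type*} {mΩ : MeasurableSpace Ω} {P : Measure Ω} {ℱ : Filtration ℕ mΩ}

/-- Log-exponential process of a noise sequence `η`, in which only the steps `s` with `ω ∈ D s`
contribute. -/
noncomputable def logExpProcess (η : ℕ → Ω → ℝ) (D : ℕ → Set Ω) (l : ℝ) (t : ℕ) (ω : Ω) : ℝ :=
  ∑ s ∈ Finset.range t, (D s).indicator (fun ω => l * η s ω - l ^ 2 / 2) ω

lemma measurable_logExpProcess {η : ℕ → Ω → ℝ} {D : ℕ → Set Ω}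
    (hη : ∀ t, Measurable[ℱ (t + 1)] (η t)) (hD : ∀ t, MeasurableSet[ℱ t] (D t)) (l : ℝ) (t : ℕ) :
    Measurable[ℱ t] (logExpProcess η D l t) := by
  unfold logExpProcess
  refine Finset.measurable_fun_sum _ fun s hs => ?_
  have hst : s < t := Finset.mem_range.1 hs
  refine Measurable.indicator ?_ (ℱ.mono hst.le _ (hD s))
  exact (((hη s).mono (ℱ.mono hst) le_rfl).const_mul l).sub_const _

lemma integrable_exp_logExpProcess [IsProbabilityMeasure P] {η : ℕ → Ω → ℝ} {D : ℕ → Set Ω}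
    (hη : ∀ t, Measurable[ℱ (t + 1)] (η t)) (hD : ∀ t, MeasurableSet[ℱ t] (D t))
    (hint : ∀ t l, Integrable (fun ω => Real.exp (l * η t ω)) P) (l : ℝ) (t : ℕ) (p : ℝ) :
    Integrable (fun ω => Real.exp (p * logExpProcess η D l t ω)) P := by
  -- The bound `exp (p(z+d)) ≤ exp (2pz) + exp (2pd)` replaces Hölder's inequality but doubles the
  -- exponent, so the induction runs over all `p`.
  induction t generalizing p with
  | zero => simp [logExpProcess]
  | succ t ih =>
    have hd : Integrable (fun ω =>
        Real.exp (2 * p * l * η t ω) * Real.exp (- (p * l ^ 2)) + 1) P :=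
      ((hint t (2 * p * l)).mul_const _).add (integrable_const _)
    refine ((ih (2 * p)).add hd).mono' ?_ (Filter.Eventually.of_forall fun ω => ?_)
    · have h := (measurable_logExpProcess hη hD l (t + 1)).mono (ℱ.le (t + 1)) le_rfl
      exact (Real.measurable_exp.comp (h.const_mul p)).aestronglyMeasurable
    · set z := logExpProcess η D l t ω
      set d := (D t).indicator (fun ω => l * η t ω - l ^ 2 / 2) ω with hdd
      have hz : logExpProcess η D l (t + 1) ω = z + d := by
        simp only [logExpProcess, Finset.sum_range_succ, z, d]
      have h1 : Real.exp (p * (z + d)) ≤ Real.exp (2 * p * z) + Real.exp (2 * p * d) := by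
        rcases le_total (p * z) (p * d) with h | h
        · have : Real.exp (p * (z + d)) ≤ Real.exp (2 * p * d) :=
            Real.exp_le_exp.2 (by linarith)
          linarith [Real.exp_pos (2 * p * z)]
        · have : Real.exp (p * (z + d)) ≤ Real.exp (2 * p * z) :=
            Real.exp_le_exp.2 (by linarith)
          linarith [Real.exp_pos (2 * p * d)]
      have h2 : Real.exp (2 * p * d) ≤
          Real.exp (2 * p * l * η t ω) * Real.exp (- (p * l ^ 2)) + 1 := by
        by_cases hω : ω ∈ D t
        · rw [hdd, Set.indicator_of_mem hω, ← Real.exp_add]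
          have : 2 * p * (l * η t ω - l ^ 2 / 2) = 2 * p * l * η t ω + - (p * l ^ 2) := by ring
          rw [this]
          linarith
        · rw [hdd, Set.indicator_of_notMem hω, mul_zero, Real.exp_zero]
          have := mul_pos (Real.exp_pos (2 * p * l * η t ω)) (Real.exp_pos (- (p * l ^ 2)))
          linarith
      rw [hz, Real.norm_eq_abs, abs_of_pos (Real.exp_pos _)]
      simp only [Pi.add_apply]
      linarith

/-- Whether step `t` contributes is known to `ℱ t`. On `D t` the conditional mean of the new factor
is at most one; off `D t` the process does not move. -/
lemma integral_exp_logExpProcess_le_one [IsProbabilityMeasure P] {η : ℕ → Ω → ℝ} {D : ℕ → Set Ω}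
    (hη : ∀ t, Measurable[ℱ (t + 1)] (η t)) (hD : ∀ t, MeasurableSet[ℱ t] (D t))
    (hint : ∀ t l, Integrable (fun ω => Real.exp (l * η t ω)) P)
    (hsub : ∀ t l, P[fun ω => Real.exp (l * η t ω) | ℱ t] ≤ᵐ[P] fun _ => Real.exp (l ^ 2 / 2))
    (l : ℝ) (t : ℕ) :
    ∫ ω, Real.exp (logExpProcess η D l t ω) ∂P ≤ 1 := by
  induction t with
  | zero => simp [logExpProcess]
  | succ t ih =>
    have hI : ∀ t, Integrable (fun ω => Real.exp (logExpProcess η D l t ω)) P := fun t => by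
      simpa using integrable_exp_logExpProcess hη hD hint l t 1
    set W : Ω → ℝ := fun ω => Real.exp (logExpProcess η D l t ω) with hW
    have hWm : Measurable[ℱ t] W :=
      Real.measurable_exp.comp (measurable_logExpProcess hη hD l t)
    have hDm : MeasurableSet (D t) := ℱ.le t _ (hD t)
    set V : Ω → ℝ := (D t).indicator W with hV
    have hVm : StronglyMeasurable[ℱ t] V := (hWm.indicator (hD t)).stronglyMeasurable
    have hVI : Integrable V P := (hI t).indicator hDm
    have hV0 : ∀ ω, 0 ≤ V ω := fun ω =>
      Set.indicator_nonneg (fun ω _ => (Real.exp_pos _).le) ω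
    set E : Ω → ℝ := fun ω => Real.exp (l * η t ω) with hE
    have hsplit : (fun ω => Real.exp (logExpProcess η D l (t + 1) ω)) =
        fun ω => Real.exp (- (l ^ 2 / 2)) * (V * E) ω + (D t)ᶜ.indicator W ω := by
      funext ω
      have hz : logExpProcess η D l (t + 1) ω = logExpProcess η D l t ω
          + (D t).indicator (fun ω => l * η t ω - l ^ 2 / 2) ω := by
        simp only [logExpProcess, Finset.sum_range_succ]
      by_cases hω : ω ∈ D t
      · have h' : ω ∉ (D t)ᶜ := fun h => h hω
        simp only [hz, hV, hE, hW, Pi.mul_apply, Set.indicator_of_mem hω,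
          Set.indicator_of_notMem h', add_zero, ← Real.exp_add]
        congr 1
        ring
      · have h' : ω ∈ (D t)ᶜ := hω
        simp only [hz, hV, hW, Pi.mul_apply, Set.indicator_of_mem h',
          Set.indicator_of_notMem hω, add_zero, zero_mul, mul_zero, zero_add]
    have hcI : Integrable ((D t)ᶜ.indicator W) P := (hI t).indicator hDm.compl
    -- A product of integrable functions need not be integrable; this one is, on `D t`, a constant
    -- times the exponential at time `t + 1`.
    have hVE : Integrable (V * E) P := by
      have h1 : Integrable ((D t).indicator fun ω =>
          Real.exp (l ^ 2 / 2) * Real.exp (logExpProcess η D l (t + 1) ω)) P :=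
        ((hI (t + 1)).const_mul _).indicator hDm
      refine h1.congr (Filter.Eventually.of_forall fun ω => ?_)
      by_cases hω : ω ∈ D t
      · have h' : ω ∉ (D t)ᶜ := fun h => h hω
        have h2 := congrFun hsplit ω
        simp only [Set.indicator_of_notMem h', add_zero] at h2
        simp only [Set.indicator_of_mem hω]
        rw [h2, ← mul_assoc, ← Real.exp_add]
        simp
      · simp [hV, hω]
    have hkey : ∫ ω, (V * E) ω ∂P ≤ Real.exp (l ^ 2 / 2) * ∫ ω, V ω ∂P := by
      rw [← integral_condExp (ℱ.le t), ← integral_const_mul]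
      refine integral_mono_ae integrable_condExp (hVI.const_mul _) ?_
      filter_upwards [condExp_mul_of_stronglyMeasurable_left hVm hVE (hint t l), hsub t l]
        with ω h1 h2
      rw [h1, Pi.mul_apply, mul_comm]
      exact mul_le_mul_of_nonneg_right h2 (hV0 ω)
    have hsum : ∫ ω, V ω ∂P + ∫ ω, (D t)ᶜ.indicator W ω ∂P = ∫ ω, W ω ∂P := by
      rw [hV, integral_indicator hDm, integral_indicator hDm.compl]
      exact integral_add_compl hDm (hI t)
    rw [hsplit, integral_add (hVE.const_mul _) hcI, integral_const_mul]
    have h3 : Real.exp (- (l ^ 2 / 2)) * ∫ ω, (V * E) ω ∂P ≤ ∫ ω, V ω ∂P := by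
      calc _ ≤ Real.exp (- (l ^ 2 / 2)) * (Real.exp (l ^ 2 / 2) * ∫ ω, V ω ∂P) :=
            mul_le_mul_of_nonneg_left hkey (Real.exp_pos _).le
        _ = _ := by rw [← mul_assoc, ← Real.exp_add]; simp
    linarith

lemma measureReal_log_le_logExpProcess_le [IsProbabilityMeasure P] {η : ℕ → Ω → ℝ} {D : ℕ → Set Ω}
    (hη : ∀ t, Measurable[ℱ (t + 1)] (η t)) (hD : ∀ t, MeasurableSet[ℱ t] (D t))
    (hint : ∀ t l, Integrable (fun ω => Real.exp (l * η t ω)) P)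
    (hsub : ∀ t l, P[fun ω => Real.exp (l * η t ω) | ℱ t] ≤ᵐ[P] fun _ => Real.exp (l ^ 2 / 2))
    (l : ℝ) (t : ℕ) {δ : ℝ} (hδ : 0 < δ) :
    P.real {ω | Real.log (1 / δ) ≤ logExpProcess η D l t ω} ≤ δ := by
  have hI : Integrable (fun ω => Real.exp (logExpProcess η D l t ω)) P := by
    simpa using integrable_exp_logExpProcess hη hD hint l t 1
  have h := mul_meas_ge_le_integral_of_nonneg
    (Filter.Eventually.of_forall fun ω => (Real.exp_pos (logExpProcess η D l t ω)).le) hI (1 / δ)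
  have hset : {ω | 1 / δ ≤ Real.exp (logExpProcess η D l t ω)}
      = {ω | Real.log (1 / δ) ≤ logExpProcess η D l t ω} := by
    ext ω
    exact (Real.log_le_iff_le_exp (by positivity)).symm
  rw [hset] at h
  have h' := h.trans (integral_exp_logExpProcess_le_one hη hD hint hsub l t)
  calc _ = δ * (1 / δ * P.real {ω | Real.log (1 / δ) ≤ logExpProcess η D l t ω}) := by
        field_simp
    _ ≤ δ := mul_le_of_le_one_right hδ.le h'

end Concentration

variable {M K : ℕ}

/-! ### Counting pulls -/

section Pulls

lemma pulls_mono (a : ℕ → Fin M × Fin K) (j : Fin M × Fin K) : Monotone fun t => pulls a t j :=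
  fun _ _ h => Finset.card_le_card
    (Finset.filter_subset_filter _ (Finset.range_subset_range.2 h))

lemma pulls_succ (a : ℕ → Fin M × Fin K) (t : ℕ) (j : Fin M × Fin K) :
    pulls a (t + 1) j = pulls a t j + if a t = j then 1 else 0 := by
  unfold pulls
  rw [Finset.range_add_one, Finset.filter_insert]
  split_ifs
  · rw [Finset.card_insert_of_notMem (by simp)]
  · rfl

lemma pulls_le (a : ℕ → Fin M × Fin K) (t : ℕ) (j : Fin M × Fin K) : pulls a t j ≤ t := by
  simpa [pulls] using Finset.card_filter_le (Finset.range t) fun s => a s = j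

lemma pulls_eq_add_card (a : ℕ → Fin M × Fin K) {s t : ℕ} (h : s ≤ t) (j : Fin M × Fin K) :
    pulls a t j = pulls a s j + ((Finset.Ico s t).filter fun r => a r = j).card := by
  induction t, h using Nat.le_induction with
  | base => simp
  | succ t hst ih =>
    rw [pulls_succ, ih, ← Finset.insert_Ico_right_eq_Ico_add_one hst, Finset.filter_insert]
    split_ifs
    · rw [Finset.card_insert_of_notMem (by simp), add_assoc]
    · rfl

lemma PullsEachOnce.injOn {a : ℕ → Fin M × Fin K} {s s' : ℕ} {B : Finset (Fin M × Fin K)}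
    (h : PullsEachOnce a s s' B) : Set.InjOn a (Finset.Ico s s') := by
  refine Finset.injOn_of_card_image_eq ?_
  rw [h.2, Nat.card_Ico, h.1]
  omega

lemma PullsEachOnce.mem {a : ℕ → Fin M × Fin K} {s s' t : ℕ} {B : Finset (Fin M × Fin K)}
    (h : PullsEachOnce a s s' B) (hst : s ≤ t) (hts : t < s') : a t ∈ B := by
  rw [← h.2]
  exact Finset.mem_image_of_mem _ (Finset.mem_Ico.2 ⟨hst, hts⟩)

lemma PullsEachOnce.pulls_eq {a : ℕ → Fin M × Fin K} {s s' : ℕ} {B : Finset (Fin M × Fin K)}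
    (h : PullsEachOnce a s s' B) {j : Fin M × Fin K} (hj : j ∈ B) :
    pulls a s' j = pulls a s j + 1 := by
  have hs : s ≤ s' := by rw [h.1]; omega
  rw [pulls_eq_add_card a hs]
  congr 1
  rw [← h.2] at hj
  obtain ⟨r, hr, rfl⟩ := Finset.mem_image.1 hj
  rw [Finset.card_eq_one]
  refine ⟨r, Finset.ext fun q => ?_⟩
  rw [Finset.mem_filter, Finset.mem_singleton]
  refine ⟨fun hq => h.injOn hq.1 hr hq.2, ?_⟩
  rintro rfl
  exact ⟨hr, rfl⟩

/-- No arm occurs twice in a round, so at its pull its count is still the one at the start of the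
round. -/
lemma PullsEachOnce.pulls_self {a : ℕ → Fin M × Fin K} {s s' t : ℕ} {B : Finset (Fin M × Fin K)}
    (h : PullsEachOnce a s s' B) (hst : s ≤ t) (hts : t < s') :
    pulls a t (a t) = pulls a s (a t) := by
  rw [pulls_eq_add_card a hst, Nat.add_eq_left, Finset.card_eq_zero,
    Finset.filter_eq_empty_iff]
  intro r hr he
  rw [Finset.mem_Ico] at hr
  have := h.injOn (Finset.mem_coe.2 (Finset.mem_Ico.2 ⟨hr.1, hr.2.trans hts⟩))
    (Finset.mem_coe.2 (Finset.mem_Ico.2 ⟨hst, hts⟩)) he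
  omega

/-- A bound on the number of earlier pulls, valid at each pull, bounds the number of pulls. -/
lemma pulls_le_one_add {a : ℕ → Fin M × Fin K} {T : ℕ} {j : Fin M × Fin K} {b : ℝ} (hb : 0 ≤ b)
    (h : ∀ t < T, a t = j → (pulls a t j : ℝ) ≤ b) : (pulls a T j : ℝ) ≤ 1 + b := by
  induction T with
  | zero => simp [pulls]; linarith
  | succ T ih =>
    rw [pulls_succ]
    split_ifs with hj
    · have := h T T.lt_succ_self hj
      push_cast
      linarith
    · simpa using ih fun t ht => h t (ht.trans T.lt_succ_self)

/-- Summing over the first `n` pulls of `j` gives the sum over the pulls before `t`, if there are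
`n` of them. -/
lemma sum_first_pulls (a : ℕ → Fin M × Fin K) {t T n : ℕ} (htT : t ≤ T) (j : Fin M × Fin K)
    (hn : pulls a t j = n) (y : ℕ → ℝ) :
    (∑ s ∈ Finset.range T, if a s = j ∧ pulls a s j < n then y s else 0)
      = ∑ s ∈ (Finset.range t).filter fun s => a s = j, y s := by
  rw [← Finset.sum_filter]
  refine Finset.sum_congr (Finset.ext fun s => ?_) fun _ _ => rfl
  simp only [Finset.mem_filter, Finset.mem_range]
  constructor
  · rintro ⟨-, hj, hlt⟩
    refine ⟨?_, hj⟩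
    by_contra hts
    have : pulls a t j ≤ pulls a s j := pulls_mono a j (not_lt.1 hts)
    omega
  · rintro ⟨hst, hj⟩
    refine ⟨hst.trans_le htT, hj, ?_⟩
    have h1 : pulls a (s + 1) j ≤ pulls a t j := pulls_mono a j hst
    rw [pulls_succ, if_pos hj] at h1
    omega

lemma regret_eq_sum [NeZero M] [NeZero K] (μ : Fin M → Fin K → ℝ) (a : ℕ → Fin M × Fin K) (T : ℕ) :
    regret μ a T = ∑ m, ∑ k, (pulls a T (m, k) : ℝ) * gap μ m k := by
  rw [← Fintype.sum_prod_type' fun m k => (pulls a T (m, k) : ℝ) * gap μ m k]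
  unfold regret
  rw [← Finset.sum_fiberwise (Finset.range T) a]
  refine Finset.sum_congr rfl fun j _ => ?_
  rw [Finset.sum_congr rfl (g := fun _ => gap μ j.1 j.2), Finset.sum_const, nsmul_eq_mul]
  · rfl
  · intro s hs
    rw [← (Finset.mem_filter.1 hs).2]
    rfl

end Pulls

/-! ### The confidence event and its probability -/

/-- Up to time `T`, the means lie inside the confidence intervals of the arms pulled so far. -/
def ConfidenceHolds (δ : ℝ) (μ : Fin M → Fin K → ℝ) (a : ℕ → Fin M × Fin K) (x : ℕ → ℝ)
    (T : ℕ) : Prop :=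
  ∀ t < T, ∀ j, 0 < pulls a t j → |empMean a x t j - μ j.1 j.2| ≤ width δ a t j

section Failure

/-- If a confidence interval fails, one of the two log-exponential processes that stop at the
corresponding number of pulls is large. -/
lemma log_le_sum_of_width_lt {δ : ℝ} (hδ0 : 0 < δ) (hδ1 : δ < 1) (μ : Fin M → Fin K → ℝ)
    (a : ℕ → Fin M × Fin K) (x : ℕ → ℝ) {t T n : ℕ} (htT : t ≤ T) (j : Fin M × Fin K)
    (hn : pulls a t j = n) (hn0 : 0 < n) {σ : ℝ} (hσ : σ ^ 2 = 1)
    (h : width δ a t j < σ * (empMean a x t j - μ j.1 j.2)) :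
    Real.log (1 / δ) ≤ ∑ s ∈ Finset.range T, if a s = j ∧ pulls a s j < n then
      σ * √(2 * Real.log (1 / δ) / n) * (x s - μ (a s).1 (a s).2)
        - (σ * √(2 * Real.log (1 / δ) / n)) ^ 2 / 2 else 0 := by
  have hL : 0 < Real.log (1 / δ) := Real.log_pos (by rw [lt_div_iff₀ hδ0]; linarith)
  have hnR : (0 : ℝ) < n := by exact_mod_cast hn0
  rw [sum_first_pulls a htT j hn]
  set L := Real.log (1 / δ)
  set w := √(2 * L / n) with hw
  have hw2 : w ^ 2 = 2 * L / n := Real.sq_sqrt (by positivity)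
  have hwpos : 0 < w := Real.sqrt_pos.2 (by positivity)
  have hwidth : width δ a t j = w := by rw [width, hn]
  have hsum : ∑ s ∈ (Finset.range t).filter fun s => a s = j,
      (σ * w * (x s - μ (a s).1 (a s).2) - (σ * w) ^ 2 / 2)
      = σ * w * (n * (empMean a x t j - μ j.1 j.2)) - n * (w ^ 2 / 2) := by
    have hcard : ((Finset.range t).filter fun s => a s = j).card = n := hn
    rw [Finset.sum_congr rfl (g := fun s => σ * w * (x s - μ j.1 j.2) - (σ * w) ^ 2 / 2),
      Finset.sum_sub_distrib, ← Finset.mul_sum, Finset.sum_sub_distrib, Finset.sum_const,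
      Finset.sum_const, hcard, empMean, hn, mul_pow, hσ, nsmul_eq_mul, nsmul_eq_mul]
    · field_simp
    · intro s hs
      rw [(Finset.mem_filter.1 hs).2]
  rw [hsum]
  rw [hwidth] at h
  -- The choice `w = √(2L/n)` makes the exponent at least `n w² - n w²/2 = L`.
  have h1 : w * n * w ≤ w * n * (σ * (empMean a x t j - μ j.1 j.2)) :=
    mul_le_mul_of_nonneg_left h.le (by positivity)
  have h2 : n * w ^ 2 = 2 * L := by rw [hw2]; field_simp
  nlinarith

end Failure

section Probability

variable {Ω : Type*} {mΩ : MeasurableSpace Ω} {P : Measure Ω} {ℱ : Filtration ℕ mΩ}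
  {μ : Fin M → Fin K → ℝ} {a : ℕ → Ω → Fin M × Fin K} {X : ℕ → Ω → ℝ}

/-- Predictability: the arms up to step `s` decide the event, and all of them are known to `ℱ s`. -/
lemma IsBanditInteraction.measurableSet_first_pulls (h : IsBanditInteraction P ℱ μ a X)
    (j : Fin M × Fin K) (n s : ℕ) :
    MeasurableSet[ℱ s] {ω | a s ω = j ∧ pulls (fun t => a t ω) s j < n} := by
  have ha : ∀ r ≤ s, MeasurableSet[ℱ s] {ω | a r ω = j} := fun r hr =>
    ℱ.mono hr _ (h.measurable_arm r (measurableSet_singleton j))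
  have hp : ∀ r ≤ s, Measurable[ℱ s] fun ω => pulls (fun t => a t ω) r j := by
    intro r
    induction r with
    | zero => intro _; simp [pulls]
    | succ r ih =>
      intro hr
      simp only [pulls_succ]
      exact (ih (by omega)).add
        (Measurable.ite (ha r (by omega)) measurable_const measurable_const)
  exact (ha s le_rfl).inter (hp s le_rfl (measurableSet_Iio (a := n)))

lemma IsBanditInteraction.measurable_noise (h : IsBanditInteraction P ℱ μ a X) (t : ℕ) :
    Measurable[ℱ (t + 1)] fun ω => X t ω - μ (a t ω).1 (a t ω).2 := by
  refine (h.measurable_reward t).sub ?_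
  exact (measurable_of_finite fun j : Fin M × Fin K => μ j.1 j.2).comp
    ((h.measurable_arm t).mono (ℱ.mono t.le_succ) le_rfl)

lemma IsBanditInteraction.measureReal_not_confidenceHolds_le [IsProbabilityMeasure P]
    (h : IsBanditInteraction P ℱ μ a X) {δ : ℝ} (hδ0 : 0 < δ) (hδ1 : δ < 1) (T : ℕ) :
    P.real {ω | ¬ ConfidenceHolds δ μ (fun t => a t ω) (fun t => X t ω) T}
      ≤ 2 * δ * M * K * T := by
  classical
  let D : Fin M × Fin K → ℕ → ℕ → Set Ω := fun j n s =>
    {ω | a s ω = j ∧ pulls (fun t => a t ω) s j < n}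
  let Z : ℝ → Fin M × Fin K → ℕ → Ω → ℝ := fun σ j n =>
    logExpProcess (fun t ω => X t ω - μ (a t ω).1 (a t ω).2) (D j n)
      (σ * √(2 * Real.log (1 / δ) / n)) T
  let E : ℝ → Fin M × Fin K → ℕ → Set Ω := fun σ j n => {ω | Real.log (1 / δ) ≤ Z σ j n ω}
  have hE : ∀ σ j n, P.real (E σ j n) ≤ δ := fun σ j n =>
    measureReal_log_le_logExpProcess_le h.measurable_noise (h.measurableSet_first_pulls j n)
      h.integrable_exp h.condExp_exp_le _ T hδ0
  -- The union runs over arms and counts, not times: in place of the random count at `t`, a fixed `n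
  -- ≤ T` is used, for which the weight is deterministic.
  have hsub : {ω | ¬ ConfidenceHolds δ μ (fun t => a t ω) (fun t => X t ω) T} ⊆
      ⋃ q ∈ (Finset.univ : Finset (Fin M × Fin K)) ×ˢ Finset.Icc 1 T,
        (E 1 q.1 q.2 ∪ E (-1) q.1 q.2) := by
    intro ω hω
    simp only [ConfidenceHolds, Set.mem_ofPred_eq, not_forall, not_le] at hω
    obtain ⟨t, htT, j, hpos, hlt⟩ := hω
    have key : ∀ σ : ℝ, σ ^ 2 = 1 →
        width δ (fun t => a t ω) t j
          < σ * (empMean (fun t => a t ω) (fun t => X t ω) t j - μ j.1 j.2) →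
        ω ∈ E σ j (pulls (fun t => a t ω) t j) := by
      intro σ hσ hlt
      have := log_le_sum_of_width_lt hδ0 hδ1 μ (fun t => a t ω) (fun t => X t ω) htT.le j rfl
        hpos hσ hlt
      simpa only [E, Z, D, logExpProcess, Set.mem_ofPred_eq, Set.indicator_apply] using this
    refine Set.mem_biUnion (x := (j, pulls (fun t => a t ω) t j)) ?_ ?_
    · simp only [Finset.coe_product, Finset.coe_univ, Finset.coe_Icc, Set.mem_prod, Set.mem_univ,
        true_and, Set.mem_Icc]
      exact ⟨hpos, (pulls_le _ _ _).trans htT.le⟩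
    · rcases lt_abs.1 hlt with h1 | h1
      · exact Or.inl (key 1 (by norm_num) (by rwa [one_mul]))
      · exact Or.inr (key (-1) (by norm_num) (by rwa [neg_one_mul]))
  calc P.real {ω | ¬ ConfidenceHolds δ μ (fun t => a t ω) (fun t => X t ω) T}
      ≤ P.real (⋃ q ∈ (Finset.univ : Finset (Fin M × Fin K)) ×ˢ Finset.Icc 1 T,
        (E 1 q.1 q.2 ∪ E (-1) q.1 q.2)) := measureReal_mono hsub (measure_ne_top _ _)
    _ ≤ ∑ q ∈ (Finset.univ : Finset (Fin M × Fin K)) ×ˢ Finset.Icc 1 T,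
        P.real (E 1 q.1 q.2 ∪ E (-1) q.1 q.2) := measureReal_biUnion_finset_le _ _
    _ ≤ ∑ _q ∈ (Finset.univ : Finset (Fin M × Fin K)) ×ˢ Finset.Icc 1 T, (2 * δ) :=
        Finset.sum_le_sum fun q _ => (measureReal_union_le _ _).trans
          (by linarith [hE 1 q.1 q.2, hE (-1) q.1 q.2])
    _ = 2 * δ * M * K * T := by
        simp only [Finset.sum_const, Finset.card_product, Finset.card_univ, Fintype.card_prod,
          Fintype.card_fin, Nat.card_Icc, Nat.add_sub_cancel, nsmul_eq_mul]
        push_cast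
        ring

end Probability

/-! ### Pathwise analysis of a run -/

section Run

variable {δ : ℝ} {μ : Fin M → Fin K → ℝ} {a : ℕ → Fin M × Fin K} {x : ℕ → ℝ} {τ : ℕ → ℕ}

/-- The defining property of the times `τ i` at which the iterations of a run start. -/
def IsRunSchedule (δ : ℝ) (a : ℕ → Fin M × Fin K) (x : ℕ → ℝ) (τ : ℕ → ℕ) : Prop :=
  PullsEachOnce a 0 (τ 0) Finset.univ ∧
    ∀ i : ℕ,
      ((activeSet δ a x τ i).card = 0 → PullsEachOnce a (τ i) (τ (i + 1)) Finset.univ) ∧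
      ((activeSet δ a x τ i).card = 1 →
        τ (i + 1) = τ i + 1 ∧ (a (τ i)).1 ∈ activeSet δ a x τ i ∧
        ∀ k : Fin K,
          empMean a x (τ i) ((a (τ i)).1, k) + width δ a (τ i) ((a (τ i)).1, k)
            ≤ empMean a x (τ i) (a (τ i)) + width δ a (τ i) (a (τ i))) ∧
      (1 < (activeSet δ a x τ i).card →
        PullsEachOnce a (τ i) (τ (i + 1)) (activeSet δ a x τ i ×ˢ Finset.univ))

lemma activeSet_antitone (δ : ℝ) (a : ℕ → Fin M × Fin K) (x : ℕ → ℝ) (τ : ℕ → ℕ) :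
    Antitone (activeSet δ a x τ) := by
  intro i i' hi m hm
  simp only [activeSet, Finset.mem_filter, Finset.mem_univ, true_and] at hm ⊢
  exact fun j hj => hm j (hj.trans hi)

/-- Every iteration makes at least one pull, so the iterations cover all times from `τ 0` on. -/
lemma IsRunSchedule.strictMono [NeZero M] [NeZero K] (h : IsRunSchedule δ a x τ) :
    StrictMono τ := by
  refine strictMono_nat_of_lt_succ fun i => ?_
  obtain ⟨h0, h1, h2⟩ := h.2 i
  have hK : 0 < K := NeZero.pos K
  have hM : 0 < M := NeZero.pos M
  rcases Nat.lt_trichotomy (activeSet δ a x τ i).card 1 with hc | hc | hc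
  · have := (h0 (by omega)).1
    rw [Finset.card_univ, Fintype.card_prod, Fintype.card_fin, Fintype.card_fin] at this
    have := Nat.mul_pos hM hK
    omega
  · have := (h1 hc).1
    omega
  · have := (h2 hc).1
    rw [Finset.card_product, Finset.card_univ, Fintype.card_fin] at this
    have := Nat.mul_pos (zero_lt_one.trans hc) hK
    omega

lemma IsRunSchedule.pulls_pos [NeZero M] [NeZero K] (h : IsRunSchedule δ a x τ) (i : ℕ)
    (j : Fin M × Fin K) : 0 < pulls a (τ i) j := by
  have h1 := h.1.pulls_eq (Finset.mem_univ j)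
  have h2 : pulls a (τ 0) j ≤ pulls a (τ i) j :=
    pulls_mono a j (h.strictMono.monotone (Nat.zero_le i))
  omega

/-- As long as two categories are active, the arms of the active categories have all been pulled
once per iteration. -/
lemma IsRunSchedule.pulls_eq (h : IsRunSchedule δ a x τ) (i : ℕ)
    (hc : 1 < (activeSet δ a x τ i).card) {m : Fin M} (hm : m ∈ activeSet δ a x τ i) (k : Fin K) :
    pulls a (τ i) (m, k) = i + 1 := by
  induction i with
  | zero => simpa [pulls] using h.1.pulls_eq (Finset.mem_univ (m, k))
  | succ i ih =>
    have hsub := activeSet_antitone δ a x τ i.le_succ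
    have hc' := hc.trans_le (Finset.card_le_card hsub)
    rw [((h.2 i).2.2 hc').pulls_eq (Finset.mem_product.2 ⟨hsub hm, Finset.mem_univ _⟩),
      ih hc' (hsub hm)]

/-- Squaring turns a gap bound into a count bound. It serves with `c = 4` for elimination and `c =
2` for UCB. -/
lemma pulls_le_of_le_width (hδ0 : 0 < δ) (hδ1 : δ < 1) {t : ℕ} {j : Fin M × Fin K} {g c : ℝ}
    (hg : 0 < g) (hpos : 0 < pulls a t j) (h : g ≤ c * width δ a t j) :
    (pulls a t j : ℝ) ≤ c ^ 2 * (2 * Real.log (1 / δ)) / g ^ 2 := by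
  have hL : 0 < Real.log (1 / δ) := Real.log_pos (by rw [lt_div_iff₀ hδ0]; linarith)
  have hn : (0 : ℝ) < pulls a t j := by exact_mod_cast hpos
  have hw : width δ a t j ^ 2 = 2 * Real.log (1 / δ) / pulls a t j :=
    Real.sq_sqrt (by positivity)
  have h2 : g ^ 2 ≤ c ^ 2 * (2 * Real.log (1 / δ) / pulls a t j) := by
    rw [← hw, ← mul_pow]
    exact pow_le_pow_left₀ hg.le h 2
  rw [← mul_div_assoc, le_div_iff₀ hn] at h2
  rw [le_div_iff₀ (by positivity)]
  linarith

variable [NeZero M] [NeZero K]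

/-- The dominating category passes the tests. -/
lemma passesTest_zero {T t : ℕ}
    (hdom : ∀ m : Fin M, m ≠ 0 → StronglyDominates (μ 0) (μ m))
    (hconf : ConfidenceHolds δ μ a x T) (ht : t < T) (hpos : ∀ j, 0 < pulls a t j) :
    PassesTest δ a x t 0 := by
  intro n hn
  refine ciSup_le fun l => le_ciInf fun k => ?_
  have h1 := (abs_le.1 (hconf t ht (n, l) (hpos _))).2
  have h2 := (abs_le.1 (hconf t ht (0, k) (hpos _))).1
  have h3 := hdom n hn k l
  simp only at h1 h2
  linarith

lemma IsRunSchedule.zero_mem_activeSet (h : IsRunSchedule δ a x τ) {T i : ℕ}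
    (hdom : ∀ m : Fin M, m ≠ 0 → StronglyDominates (μ 0) (μ m))
    (hconf : ConfidenceHolds δ μ a x T) (hi : τ i < T) : 0 ∈ activeSet δ a x τ i := by
  simp only [activeSet, Finset.mem_filter, Finset.mem_univ, true_and]
  exact fun j hj => passesTest_zero hdom hconf ((h.strictMono.monotone hj).trans_lt hi)
    (h.pulls_pos j)

/-- A suboptimal category that is still active has not been explored much. -/
lemma IsRunSchedule.iteration_le (hδ0 : 0 < δ) (hδ1 : δ < 1) (h : IsRunSchedule δ a x τ) {T i : ℕ}
    (hdom : ∀ m : Fin M, m ≠ 0 → StronglyDominates (μ 0) (μ m))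
    (hconf : ConfidenceHolds δ μ a x T) (hi : τ i < T) {m : Fin M} (hm0 : m ≠ 0)
    (hm : m ∈ activeSet δ a x τ i) (hg : 0 < lastGap μ m) :
    ((i + 1 : ℕ) : ℝ) ≤ 32 * Real.log (1 / δ) / lastGap μ m ^ 2 := by
  have h0 := h.zero_mem_activeSet hdom hconf hi
  have hc : 1 < (activeSet δ a x τ i).card := Finset.one_lt_card.2 ⟨m, hm, 0, h0, hm0⟩
  set e : Fin K := ⟨K - 1, Nat.sub_lt (NeZero.pos K) Nat.one_pos⟩ with he
  have hp0 := h.pulls_eq i hc h0 0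
  have hpm := h.pulls_eq i hc hm e
  have htest : bestLower δ a x (τ i) 0 ≤ worstUpper δ a x (τ i) m := by
    have : ∀ j ≤ i, PassesTest δ a x (τ j) m := by
      simpa [activeSet] using hm
    exact this i le_rfl 0 hm0.symm
  have hlow : empMean a x (τ i) (0, 0) - width δ a (τ i) (0, 0) ≤ bestLower δ a x (τ i) 0 :=
    le_ciSup (f := fun k : Fin K => empMean a x (τ i) (0, k) - width δ a (τ i) (0, k))
      (Set.finite_range _).bddAbove 0
  have hup : worstUpper δ a x (τ i) m ≤ empMean a x (τ i) (m, e) + width δ a (τ i) (m, e) :=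
    ciInf_le (f := fun k : Fin K => empMean a x (τ i) (m, k) + width δ a (τ i) (m, k))
      (Set.finite_range _).bddBelow e
  have h1 := (abs_le.1 (hconf _ hi (0, 0) (h.pulls_pos i _))).1
  have h2 := (abs_le.1 (hconf _ hi (m, e) (h.pulls_pos i _))).2
  have hw : width δ a (τ i) (0, 0) = width δ a (τ i) (m, e) := by
    rw [width, width, hp0, hpm]
  -- Each of the two arms contributes two widths, one from its confidence interval and one from the
  -- test, and equal counts make all four equal.
  have hgap : lastGap μ m ≤ 4 * width δ a (τ i) (m, e) := by
    simp only [lastGap, gap, ← he] at h1 h2 ⊢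
    linarith
  have := pulls_le_of_le_width hδ0 hδ1 hg (h.pulls_pos i _) hgap
  rw [hpm] at this
  refine this.trans_eq ?_
  ring

lemma IsRunSchedule.exists_iteration (h : IsRunSchedule δ a x τ) {t : ℕ} (ht : τ 0 ≤ t) :
    ∃ i, τ i ≤ t ∧ t < τ (i + 1) := by
  have hex : ∃ i, t < τ i := ⟨t + 1, h.strictMono.le_apply⟩
  classical
  have hpos : Nat.find hex ≠ 0 := fun h0 => by
    have := Nat.find_spec hex
    rw [h0] at this
    omega
  obtain ⟨i, hi⟩ := Nat.exists_eq_succ_of_ne_zero hpos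
  refine ⟨i, not_lt.1 (Nat.find_min hex (by omega)), ?_⟩
  have := Nat.find_spec hex
  rwa [hi] at this

lemma gap_nonneg (hsorted : ∀ m, Antitone (μ m))
    (hdom : ∀ m : Fin M, m ≠ 0 → StronglyDominates (μ 0) (μ m)) (m : Fin M) (k : Fin K) :
    0 ≤ gap μ m k := by
  rw [gap, sub_nonneg]
  by_cases hm : m = 0
  · rw [hm]
    exact hsorted 0 (Fin.zero_le k)
  · exact hdom m hm 0 k

lemma gap_le_lastGap (hsorted : ∀ m, Antitone (μ m)) (m : Fin M) (k : Fin K) :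
    gap μ m k ≤ lastGap μ m := by
  refine sub_le_sub_left (hsorted m ?_) _
  rw [Fin.le_def]
  exact Nat.le_sub_one_of_lt k.2

lemma sharpGap_le_lastGap (μ : Fin M → Fin K → ℝ) {m : Fin M} (hm : m ≠ 0) :
    sharpGap μ ≤ lastGap μ m :=
  ciInf_le (f := fun m : {m : Fin M // m ≠ 0} => lastGap μ m.1)
    (Set.finite_range _).bddBelow ⟨m, hm⟩

/-- Every arm of category `0` dominates the last arms of the others. Thus a positive gap in category
`0` makes `sharpGap` positive; `2 ≤ M` keeps the infimum from being over an empty type. -/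
lemma gap_zero_le_sharpGap (hM : 2 ≤ M)
    (hdom : ∀ m : Fin M, m ≠ 0 → StronglyDominates (μ 0) (μ m)) (k : Fin K) :
    gap μ 0 k ≤ sharpGap μ := by
  have : Nonempty {m : Fin M // m ≠ 0} :=
    ⟨⟨1, hM⟩, fun h => by simpa using congrArg Fin.val h⟩
  exact le_ciInf fun m => sub_le_sub_left (hdom m.1 m.2 k _) _

/-- A pull of an arm before the horizon either is its first one, or is made in an exploration round
with another active category, or is a pull of a maximizer of the upper confidence bound in the
dominating category. -/
lemma IsRunSchedule.pull_cases (h : IsRunSchedule δ a x τ) {T t : ℕ}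
    (hdom : ∀ m : Fin M, m ≠ 0 → StronglyDominates (μ 0) (μ m))
    (hconf : ConfidenceHolds δ μ a x T) (ht : t < T) :
    pulls a t (a t) = 0 ∨
    (∃ i, τ i < T ∧ pulls a t (a t) = i + 1 ∧ (a t).1 ∈ activeSet δ a x τ i ∧
      ∃ m, m ≠ 0 ∧ m ∈ activeSet δ a x τ i) ∨
    ((a t).1 = 0 ∧ (∀ j, 0 < pulls a t j) ∧
      ∀ k, empMean a x t (0, k) + width δ a t (0, k)
        ≤ empMean a x t (a t) + width δ a t (a t)) := by
  rcases lt_or_ge t (τ 0) with h0 | h0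
  · left
    rw [h.1.pulls_self (Nat.zero_le t) h0]
    simp [pulls]
  obtain ⟨i, hi, hi'⟩ := h.exists_iteration h0
  have hiT := hi.trans_lt ht
  have hz := h.zero_mem_activeSet hdom hconf hiT
  right
  rcases Nat.lt_or_ge 1 (activeSet δ a x τ i).card with hc | hc
  · left
    have hpull := (h.2 i).2.2 hc
    have hmem := (Finset.mem_product.1 (hpull.mem hi hi')).1
    obtain ⟨m, hm, hm0⟩ := Finset.exists_mem_ne hc 0
    exact ⟨i, hiT, by rw [hpull.pulls_self hi hi', h.pulls_eq i hc hmem], hmem, m, hm0, hm⟩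
  · right
    -- Category `0` is active, so the restart with no active category cannot occur here, and a lone
    -- active category is `0`.
    have hc1 : (activeSet δ a x τ i).card = 1 :=
      le_antisymm hc (Finset.card_pos.2 ⟨0, hz⟩)
    obtain ⟨h1, h2, h3⟩ := (h.2 i).2.1 hc1
    obtain rfl : t = τ i := by omega
    have ha : (a (τ i)).1 = 0 := Finset.card_le_one.1 hc _ h2 _ hz
    rw [ha] at h3
    exact ⟨ha, h.pulls_pos i, h3⟩

lemma IsRunSchedule.pulls_mul_gap_le (hδ0 : 0 < δ) (hδ1 : δ < 1) (hsorted : ∀ m, Antitone (μ m))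
    (hdom : ∀ m : Fin M, m ≠ 0 → StronglyDominates (μ 0) (μ m))
    (h : IsRunSchedule δ a x τ) {T : ℕ} (hconf : ConfidenceHolds δ μ a x T)
    {m : Fin M} (hm : m ≠ 0) (k : Fin K) :
    (pulls a T (m, k) : ℝ) * gap μ m k ≤
      gap μ m k + 32 * Real.log (1 / δ) / lastGap μ m ^ 2 * gap μ m k := by
  have hL : 0 < Real.log (1 / δ) := Real.log_pos (by rw [lt_div_iff₀ hδ0]; linarith)
  -- A zero gap kills both sides, whatever the quotient is read as; a positive one makes `lastGap`
  -- positive.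
  rcases (gap_nonneg hsorted hdom m k).eq_or_lt with hg | hg
  · simp [← hg]
  have hlast := hg.trans_le (gap_le_lastGap hsorted m k)
  have hb : 0 ≤ 32 * Real.log (1 / δ) / lastGap μ m ^ 2 := by positivity
  have hp : (pulls a T (m, k) : ℝ) ≤ 1 + 32 * Real.log (1 / δ) / lastGap μ m ^ 2 := by
    refine pulls_le_one_add hb fun t ht hat => ?_
    have hcases := h.pull_cases hdom hconf ht
    rw [hat] at hcases
    rcases hcases with h1 | ⟨i, hi, h1, h2, -⟩ | ⟨h1, -⟩
    · rw [h1]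
      simpa using hb
    · rw [h1]
      exact h.iteration_le hδ0 hδ1 hdom hconf hi hm h2 hlast
    · exact absurd h1 hm
  calc _ ≤ (1 + 32 * Real.log (1 / δ) / lastGap μ m ^ 2) * gap μ m k :=
        mul_le_mul_of_nonneg_right hp hg.le
    _ = _ := by ring

lemma IsRunSchedule.pulls_zero_mul_gap_le (hM : 2 ≤ M) (hδ0 : 0 < δ) (hδ1 : δ < 1)
    (hsorted : ∀ m, Antitone (μ m))
    (hdom : ∀ m : Fin M, m ≠ 0 → StronglyDominates (μ 0) (μ m))
    (h : IsRunSchedule δ a x τ) {T : ℕ} (hconf : ConfidenceHolds δ μ a x T) (k : Fin K) :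
    (pulls a T (0, k) : ℝ) * gap μ 0 k ≤ gap μ 0 k +
      8 * max (1 / gap μ 0 k) (4 * gap μ 0 k / sharpGap μ ^ 2) * Real.log (1 / δ) := by
  have hL : 0 < Real.log (1 / δ) := Real.log_pos (by rw [lt_div_iff₀ hδ0]; linarith)
  rcases (gap_nonneg hsorted hdom 0 k).eq_or_lt with hg | hg
  · simp [← hg]
  have hsharp := hg.trans_le (gap_zero_le_sharpGap hM hdom k)
  set L := Real.log (1 / δ)
  -- The first term is the UCB bound, `8 = 2² · 2`; the second bounds the rounds shared with another
  -- category, `32 = 4² · 2`.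
  set b := max (8 * L / gap μ 0 k ^ 2) (32 * L / sharpGap μ ^ 2) with hbdef
  have hb : 0 ≤ b := le_max_of_le_left (by positivity)
  have hp : (pulls a T (0, k) : ℝ) ≤ 1 + b := by
    refine pulls_le_one_add hb fun t ht hat => ?_
    have hcases := h.pull_cases hdom hconf ht
    rw [hat] at hcases
    rcases hcases with h1 | ⟨i, hi, h1, -, m, hm0, hm⟩ | ⟨-, hpos, h1⟩
    · rw [h1]
      simpa using hb
    · rw [h1]
      have hsl := sharpGap_le_lastGap μ hm0
      refine le_max_of_le_right
        ((h.iteration_le hδ0 hδ1 hdom hconf hi hm0 hm (hsharp.trans_le hsl)).trans ?_)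
      gcongr
    · refine le_max_of_le_left ?_
      have h2 := h1 0
      have h3 := (abs_le.1 (hconf t ht (0, 0) (hpos _))).1
      have h4 := (abs_le.1 (hconf t ht (0, k) (hpos _))).2
      -- The best mean is below its own upper bound, hence below that of the pulled arm, which
      -- exceeds `μ 0 k` by at most two widths.
      have h5 : gap μ 0 k ≤ 2 * width δ a t (0, k) := by
        simp only [gap] at h3 h4 ⊢
        linarith
      refine (pulls_le_of_le_width hδ0 hδ1 hg (hpos _) h5).trans_eq ?_
      ring
  have hbg : b * gap μ 0 k =
      8 * max (1 / gap μ 0 k) (4 * gap μ 0 k / sharpGap μ ^ 2) * L := by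
    rw [hbdef, max_mul_of_nonneg _ _ hg.le, mul_max_of_nonneg _ _ (by norm_num : (0 : ℝ) ≤ 8),
      max_mul_of_nonneg _ _ hL.le]
    congr 1
    · field_simp
    · ring
  calc _ ≤ (1 + b) * gap μ 0 k := mul_le_mul_of_nonneg_right hp hg.le
    _ = _ := by rw [add_mul, one_mul, hbg]

theorem IsRunSchedule.regret_le (hM : 2 ≤ M) (hδ0 : 0 < δ) (hδ1 : δ < 1)
    (hsorted : ∀ m, Antitone (μ m))
    (hdom : ∀ m : Fin M, m ≠ 0 → StronglyDominates (μ 0) (μ m))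
    (h : IsRunSchedule δ a x τ) {T : ℕ} (hconf : ConfidenceHolds δ μ a x T) :
    regret μ a T ≤
      8 * (∑ k ∈ Finset.univ.filter (fun k : Fin K => k ≠ 0),
          max (1 / gap μ 0 k) (4 * gap μ 0 k / sharpGap μ ^ 2)) * Real.log (1 / δ)
        + ∑ m : Fin M, ∑ k : Fin K, gap μ m k
        + ∑ m ∈ Finset.univ.filter (fun m : Fin M => m ≠ 0),
            32 * Real.log (1 / δ) / lastGap μ m ^ 2 * ∑ k : Fin K, gap μ m k := by
  have hzero : ∑ k, (pulls a T (0, k) : ℝ) * gap μ 0 k ≤ ∑ k, gap μ 0 k +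
      8 * (∑ k ∈ Finset.univ.filter (fun k : Fin K => k ≠ 0),
          max (1 / gap μ 0 k) (4 * gap μ 0 k / sharpGap μ ^ 2)) * Real.log (1 / δ) := by
    rw [Finset.filter_ne', Finset.mul_sum, Finset.sum_mul,
      ← Finset.add_sum_erase _ _ (Finset.mem_univ (0 : Fin K)),
      ← Finset.add_sum_erase _ (fun k => gap μ 0 k) (Finset.mem_univ (0 : Fin K)), add_assoc,
      ← Finset.sum_add_distrib]
    -- The arm `(0, 0)` has gap zero, so it drops out of the sum.
    refine add_le_add (by simp [gap]) (Finset.sum_le_sum fun k _ => ?_)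
    exact h.pulls_zero_mul_gap_le hM hδ0 hδ1 hsorted hdom hconf k
  have hother : ∑ m ∈ Finset.univ.erase (0 : Fin M), ∑ k, (pulls a T (m, k) : ℝ) * gap μ m k ≤
      ∑ m ∈ Finset.univ.erase (0 : Fin M), ∑ k, gap μ m k +
      ∑ m ∈ Finset.univ.erase (0 : Fin M),
        32 * Real.log (1 / δ) / lastGap μ m ^ 2 * ∑ k : Fin K, gap μ m k := by
    rw [← Finset.sum_add_distrib]
    refine Finset.sum_le_sum fun m hm => ?_
    rw [Finset.mul_sum, ← Finset.sum_add_distrib]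
    exact Finset.sum_le_sum fun k _ =>
      h.pulls_mul_gap_le hδ0 hδ1 hsorted hdom hconf (Finset.ne_of_mem_erase hm) k
  rw [regret_eq_sum, ← Finset.add_sum_erase _ _ (Finset.mem_univ (0 : Fin M)),
    ← Finset.add_sum_erase _ (fun m => ∑ k, gap μ m k) (Finset.mem_univ (0 : Fin M)),
    Finset.filter_ne' Finset.univ (0 : Fin M)]
  linarith

end Run

end CategorizedBandit

/-! ### Combination of the two estimates -/

theorem mainTheorem3 {Ω : Type*} {mΩ : MeasurableSpace Ω} (P : Measure Ω) [IsProbabilityMeasure P]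
    {M K : ℕ} [NeZero M] [NeZero K] (hM : 2 ≤ M)
    (μ : Fin M → Fin K → ℝ) (hsorted : ∀ m, Antitone (μ m))
    (hdom : ∀ m : Fin M, m ≠ 0 → CategorizedBandit.StronglyDominates (μ 0) (μ m))
    (δ : ℝ) (hδ0 : 0 < δ) (hδ1 : δ < 1)
    (ℱ : Filtration ℕ mΩ) (a : ℕ → Ω → Fin M × Fin K) (X : ℕ → Ω → ℝ)
    (hmodel : CategorizedBandit.IsBanditInteraction P ℱ μ a X)
    (hrun : ∀ᵐ ω ∂P, CategorizedBandit.IsMinMaxUCBRun δ (fun t => a t ω) (fun t => X t ω))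
    (T : ℕ) :
    1 - 2 * δ * M * K * T ≤
      P.real {ω | CategorizedBandit.regret μ (fun t => a t ω) T ≤
        8 * (∑ k ∈ Finset.univ.filter (fun k : Fin K => k ≠ 0),
            max (1 / CategorizedBandit.gap μ 0 k)
              (4 * CategorizedBandit.gap μ 0 k / CategorizedBandit.sharpGap μ ^ 2))
          * Real.log (1 / δ)
        + ∑ m : Fin M, ∑ k : Fin K, CategorizedBandit.gap μ m k
        + ∑ m ∈ Finset.univ.filter (fun m : Fin M => m ≠ 0),
            32 * Real.log (1 / δ) / CategorizedBandit.lastGap μ m ^ 2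
              * ∑ k : Fin K, CategorizedBandit.gap μ m k} := by
  have hbad := hmodel.measureReal_not_confidenceHolds_le hδ0 hδ1 T
  set S : Set Ω := {ω | CategorizedBandit.regret μ (fun t => a t ω) T ≤ _}
  set B : Set Ω := {ω | ¬ CategorizedBandit.ConfidenceHolds δ μ (fun t => a t ω) (fun t => X t ω) T}
  have hcover : (Set.univ : Set Ω) ≤ᵐ[P] (S ∪ B : Set Ω) := by
    filter_upwards [hrun] with ω hω _
    by_cases hconf : CategorizedBandit.ConfidenceHolds δ μ (fun t => a t ω) (fun t => X t ω) T
    · obtain ⟨τ, hτ⟩ := hω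
      exact Or.inl (CategorizedBandit.IsRunSchedule.regret_le hM hδ0 hδ1 hsorted hdom hτ hconf)
    · exact Or.inr hconf
  -- Only monotonicity and subadditivity are used, so `S` and `B` need not be shown measurable.
  have h1 : (1 : ℝ) ≤ P.real (S ∪ B) := by
    rw [← probReal_univ (μ := P)]
    exact ENNReal.toReal_mono (measure_ne_top _ _) (measure_mono_ae hcover)
  linarith [measureReal_union_le (μ := P) S B]
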